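/- For integers $d\ge 1$ and $n$, let $\mathcal J(d,n)$ be the set of all non-decreasing maps $\mathbf i:\{1,\dots,d\}\to\{1,\dots,n\}$. For every $\tau>0$ there is a constant $C_\tau>0$, depending only on $\tau$, such that for all $d\ge1$, all $n$ and every $d$-homogeneous polynomial $$P(z)=\sum_{\mathbf i\in\mathcal J(d,n)}a_{\mathbf i}\,z_{\mathbf i(1)}\cdots z_{\mathbf i(d)},\qquad z\in\mathbb C^n,$$ whose coefficients all satisfy $|a_{\mathbf i}|=1$, $\mathbf i\in\mathcal J(d,n)$, one has $$\Big(\sum_{\mathbf i\in\mathcal J(d,n)}|a_{\mathbf i}|^{\frac{2d}{d+1}}\Big)^{\frac{d+1}{2d}}\le C_\tau\, e^{\left(\frac{\sqrt2}{\sqrt3}+\tau\right)\sqrt{d\log d}}\;\|P\|_{L^\infty(\mathbb T^n)},$$ where $\mathbb T^n=\{z\in\mathbb C^n:|z_1|=\dots=|z_n|=1\}$ and $\|P\|_{L^\infty(\mathbb T^n)}=\max_{z\in\mathbb T^n}|P(z)|$. -/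

import Mathlib

noncomputable section

namespace Sidon

open Classical in
/-- The index set `J(d, n)` of all non-decreasing maps from `{1, …, d}` to `{1, …, n}`. -/
def J (d n : ℕ) : Finset (Fin d → Fin n) :=
  Finset.univ.filter fun i => Monotone i

/-- The coefficient `a_i` of the monomial `z_{i(1)} ⋯ z_{i(d)}` in the polynomial `P`. -/
def coeffAt {d n : ℕ} (P : MvPolynomial (Fin n) ℂ) (i : Fin d → Fin n) : ℂ :=
  P.coeff (∑ s, Finsupp.single (i s) 1)

/-- The norm of `P` in `L^∞(𝕋ⁿ)`: since `P` is continuous on the compact torus, this is the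
(finite) supremum of `|P|` over the torus. -/
def torusNorm {n : ℕ} (P : MvPolynomial (Fin n) ℂ) : ℝ :=
  ⨆ z : Fin n → Circle, ‖MvPolynomial.eval (fun k => (z k : ℂ)) P‖

/-- The supremum in `torusNorm` is over a bounded set. -/
theorem bddAbove_torus {n : ℕ} (P : MvPolynomial (Fin n) ℂ) :
    BddAbove (Set.range fun z : Fin n → Circle =>
      ‖MvPolynomial.eval (fun k => (z k : ℂ)) P‖) := by
  refine (isCompact_range ?_).bddAbove
  have h := MvPolynomial.continuous_eval P
  exact (h.comp (by fun_prop)).norm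

end Sidon

end

/-!
All coefficients have modulus one, so with `N = #(J d n)` the claim is a lower bound for the
supremum norm `‖P‖` on the torus: `N ^ ((d + 1) / (2 * d)) ≤ 30 * 14 ^ √d * ‖P‖`, where `14 ^ √d` is
smaller than `exp (c * √(d * log d))` up to a constant, for every `c > 0`.

If `n < d ^ 2`, it suffices that `‖P‖` is at least the `L²`-norm `√N`, because
`N ^ (1 / (2 * d)) ≤ √n ≤ d`.

If `n ≥ d ^ 2`, let `k = ⌊√d⌋` and split the variables into `k` blocks of `n₁ = ⌊n / d⌋` variables
each, and the `n₀` remaining ones. The part of `P` that is linear in each block is an average of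
rotations of `P`, hence bounded by `‖P‖` (`norm_sum_blockCoeff_le`). It is a `k`-linear form in the
blocks whose coefficients `Q j`, `j ∈ {1, …, n₁} ^ k`, are polynomials of degree `D = d - k` in the
remaining variables, again with unimodular coefficients. Two facts are combined.

* For fixed values of the remaining variables, the mixed `(ℓ¹, ℓ²)` inequality `sum_sqrt_le` bounds,
  for each block `i`, the sum over `a` of `(∑_{j i = a} |Q j| ^ 2) ^ (1 / 2)` by `2 ^ k * ‖P‖`.
* By Parseval's identity the mean of `|Q j| ^ 2` is the number `N₀` of monomials in `Q j`, and the
  mean of `|Q j| ^ 4` is at most `4 ^ D * N₀ ^ 2` (`sum_norm_pow_four_le`), since a monomial of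
  degree `2 * D` has at most `4 ^ D` divisors.

Hölder's inequality for `k + 2` functions (`sum_sq_pow_le`) interpolates between them and yields
`n₁ ^ (k + 1) * N₀ ≤ 4 ^ (2 * k + 2) * ‖P‖ ^ 2` (`card_pow_mul_card_le`). The factor `4 ^ D` enters
only through its `k`-th root, which is harmless for `k ≈ √d`, and so is the loss in
passing from all monomials to those that are linear in each block
(`pow_succ_le_torusNorm_sq`).

Integrals over tori are replaced throughout by averages over roots of unity of sufficiently high
order.
-/

noncomputable section

namespace Sidon

open Finset ComplexConjugate

/-! ### Hölder's inequality for several functions -/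

/-- Hölder's inequality for several functions with equal exponents, free of roots. -/
theorem sum_pow_card_le_prod_sum {ι X : Type*} [Fintype ι] [Nonempty ι] [Fintype X]
    (f : ι → X → ℝ) (g : X → ℝ) (hf : ∀ t x, 0 ≤ f t x) (hg : ∀ x, 0 ≤ g x)
    (h : ∀ x, g x ^ Fintype.card ι ≤ ∏ t, f t x) :
    (∑ x, g x) ^ Fintype.card ι ≤ ∏ t, ∑ x, f t x := by
  set r := Fintype.card ι with hr
  have hr0 : r ≠ 0 := Fintype.card_ne_zero
  have hrpos : (0 : ℝ) < r := by exact_mod_cast Nat.pos_of_ne_zero hr0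
  have hB : ∀ t, 0 ≤ ∑ x, f t x := fun t => sum_nonneg fun x _ => hf t x
  by_cases h0 : ∃ t, ∑ x, f t x = 0
  · obtain ⟨t, ht⟩ := h0
    have hz : ∀ x, g x = 0 := by
      intro x
      have h1 : f t x = 0 := (sum_eq_zero_iff_of_nonneg fun x _ => hf t x).1 ht x (mem_univ x)
      have h2 := h x
      rw [prod_eq_zero (mem_univ t) h1] at h2
      exact (pow_eq_zero_iff hr0).1 (le_antisymm h2 (pow_nonneg (hg x) _))
    simp only [hz, sum_const_zero, zero_pow hr0]
    exact prod_nonneg fun t _ => hB t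
  · push Not at h0
    have hBpos : ∀ t, 0 < ∑ x, f t x := fun t => lt_of_le_of_ne (hB t) (Ne.symm (h0 t))
    set B := ∏ t, ∑ x, f t x with hBdef
    have hB0 : 0 < B := prod_pos fun t _ => hBpos t
    have hroot : (B ^ (r⁻¹ : ℝ)) ^ r = B := Real.rpow_inv_natCast_pow hB0.le hr0
    have hroot0 : 0 < B ^ (r⁻¹ : ℝ) := Real.rpow_pos_of_pos hB0 _
    have key : ∀ x, g x / B ^ (r⁻¹ : ℝ) ≤ ∑ t, (r⁻¹ : ℝ) * (f t x / ∑ y, f t y) := by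
      intro x
      have hamgm := Real.geom_mean_le_arith_mean_weighted univ (fun _ : ι => (r⁻¹ : ℝ))
        (fun t => f t x / ∑ y, f t y) (fun _ _ => by positivity)
        (by simp [← hr, hrpos.ne']) (fun t _ => div_nonneg (hf t x) (hB t))
      refine le_trans ?_ hamgm
      rw [Real.finsetProd_rpow _ _ fun t _ => div_nonneg (hf t x) (hB t), prod_div_distrib]
      refine le_of_pow_le_pow_left₀ hr0
        (Real.rpow_nonneg (div_nonneg (prod_nonneg fun t _ => hf t x) hB0.le) _) ?_
      rw [Real.rpow_inv_natCast_pow (div_nonneg (prod_nonneg fun t _ => hf t x) hB0.le) hr0,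
        div_pow, hroot]
      exact div_le_div_of_nonneg_right (h x) hB0.le
    have hsum : (∑ x, g x) / B ^ (r⁻¹ : ℝ) ≤ 1 := by
      rw [sum_div]
      refine (sum_le_sum fun x _ => key x).trans ?_
      rw [sum_comm]
      have : ∀ t, ∑ x, (r⁻¹ : ℝ) * (f t x / ∑ y, f t y) = (r⁻¹ : ℝ) := by
        intro t
        rw [← mul_sum, ← sum_div, div_self (h0 t), mul_one]
      simp [this, ← hr, hrpos.ne']
    rw [div_le_one hroot0] at hsum
    calc (∑ x, g x) ^ r ≤ (B ^ (r⁻¹ : ℝ)) ^ r :=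
          pow_le_pow_left₀ (sum_nonneg fun x _ => hg x) hsum r
      _ = B := hroot

/-! ### Monomials on finite tori -/

/-- The monomial `z ^ α`. -/
def mon {ι : Type*} [Fintype ι] (α : ι → ℕ) (z : ι → Circle) : Circle := ∏ i, z i ^ α i

/-- The point of the torus whose coordinates are the `m`-th roots of unity numbered by `x`. Averages
over all `x` replace integrals over the torus; they agree on trigonometric polynomials of
degree less than `m`. -/
def rootPt {ι : Type*} {m : ℕ} [NeZero m] (x : ι → ZMod m) : ι → Circle :=
  fun i => ZMod.toCircle (x i)

section FiniteTorus

variable {ι κ : Type*} [Fintype ι]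

theorem mon_add (α β : ι → ℕ) (z : ι → Circle) : mon (α + β) z = mon α z * mon β z := by
  simp [mon, pow_add, prod_mul_distrib]

theorem coe_mon (α : ι → ℕ) (z : ι → Circle) : (mon α z : ℂ) = ∏ i, (z i : ℂ) ^ α i :=
  map_prod Circle.coeHom (fun i => z i ^ α i) univ

theorem eval_eq_sum_mon (P : MvPolynomial ι ℂ) (z : ι → Circle) :
    MvPolynomial.eval (fun i => (z i : ℂ)) P = ∑ α ∈ P.support, P.coeff α * (mon α z : ℂ) := by
  simp only [MvPolynomial.eval_eq', coe_mon]

theorem sum_eq_of_mem_support {P : MvPolynomial ι ℂ} {d : ℕ} (hP : P.IsHomogeneous d)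
    {α : ι →₀ ℕ} (hα : α ∈ P.support) : ∑ i, α i = d := by
  have := hP (MvPolynomial.mem_support_iff.1 hα)
  rwa [Pi.one_def, ← Finsupp.degree_eq_weight_one, Finsupp.degree_eq_sum] at this

theorem sum_toCircle {m : ℕ} [NeZero m] {a b : ℕ} (ha : a < m) (hb : b < m) :
    ∑ t : ZMod m, ((ZMod.toCircle t ^ a : Circle) : ℂ) * conj ((ZMod.toCircle t ^ b : Circle) : ℂ)
      = if a = b then (m : ℂ) else 0 := by
  have h := AddChar.sum_mulShift ((a : ZMod m) - (b : ZMod m)) (ZMod.isPrimitive_stdAddChar m)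
  have h1 : ∀ t : ZMod m,
      ((ZMod.toCircle t ^ a : Circle) : ℂ) * conj ((ZMod.toCircle t ^ b : Circle) : ℂ)
      = ZMod.stdAddChar (t * ((a : ZMod m) - (b : ZMod m))) := by
    intro t
    rw [ZMod.stdAddChar_apply, ← Circle.coe_inv_eq_conj, ← Circle.coe_mul, mul_sub, sub_eq_add_neg,
      AddChar.map_add_eq_mul, AddChar.map_neg_eq_inv, mul_comm t, mul_comm t, ← nsmul_eq_mul,
      ← nsmul_eq_mul, AddChar.map_nsmul_eq_pow, AddChar.map_nsmul_eq_pow]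
  rw [sum_congr rfl fun t _ => h1 t, h]
  have h2 : ((a : ZMod m) - (b : ZMod m) = 0) ↔ a = b := by
    rw [sub_eq_zero, ZMod.natCast_eq_natCast_iff']
    rw [Nat.mod_eq_of_lt ha, Nat.mod_eq_of_lt hb]
  simp only [h2, ZMod.card]
  split_ifs <;> simp

theorem sum_mon_mul_conj [DecidableEq ι] {m : ℕ} [NeZero m] {α β : ι → ℕ} (hα : ∀ i, α i < m)
    (hβ : ∀ i, β i < m) :
    ∑ x : ι → ZMod m, (mon α (rootPt x) : ℂ) * conj (mon β (rootPt x) : ℂ)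
      = if α = β then (m : ℂ) ^ Fintype.card ι else 0 := by
  have h1 : ∀ x : ι → ZMod m, (mon α (rootPt x) : ℂ) * conj (mon β (rootPt x) : ℂ)
      = ∏ i, ((ZMod.toCircle (x i) ^ α i : Circle) : ℂ) *
          conj ((ZMod.toCircle (x i) ^ β i : Circle) : ℂ) := by
    intro x
    have hc : ∀ y : ι → Circle, ((∏ i, y i : Circle) : ℂ) = ∏ i, (y i : ℂ) :=
      fun y => map_prod Circle.coeHom y univ
    simp only [mon, rootPt, hc, map_prod, prod_mul_distrib]
  rw [sum_congr rfl fun x _ => h1 x,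
    ← Fintype.prod_sum fun (i : ι) (t : ZMod m) => ((ZMod.toCircle t ^ α i : Circle) : ℂ) *
          conj ((ZMod.toCircle t ^ β i : Circle) : ℂ)]
  rw [prod_congr rfl fun i _ => sum_toCircle (hα i) (hβ i)]
  split_ifs with h
  · simp [h]
  · obtain ⟨i, hi⟩ := Function.ne_iff.1 h
    exact prod_eq_zero (mem_univ i) (if_neg hi)

/-- Parseval's identity on the finite torus. -/
theorem sum_norm_sq_eq [DecidableEq ι] {m : ℕ} [NeZero m] (K : Finset κ)
    (e : κ → ι → ℕ) (a : κ → ℂ) (he : Set.InjOn e K) (hm : ∀ t ∈ K, ∀ i, e t i < m) :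
    ∑ x : ι → ZMod m, ‖∑ t ∈ K, a t * (mon (e t) (rootPt x) : ℂ)‖ ^ 2
      = (m : ℝ) ^ Fintype.card ι * ∑ t ∈ K, ‖a t‖ ^ 2 := by
  classical
  have h1 : ∀ z : ℂ, ((‖z‖ ^ 2 : ℝ) : ℂ) = z * conj z := fun z => by
    rw [Complex.mul_conj, Complex.normSq_eq_norm_sq]
  apply Complex.ofReal_injective
  push_cast
  simp only [← Complex.ofReal_pow, h1, map_sum, map_mul, sum_mul_sum]
  rw [sum_comm, mul_sum]
  refine sum_congr rfl fun t ht => ?_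
  rw [sum_comm, sum_eq_single_of_mem t ht]
  · rw [← Complex.ofReal_natCast, ← Complex.ofReal_pow]
    have := sum_mon_mul_conj (hm t ht) (hm t ht)
    rw [if_pos rfl] at this
    rw [Complex.ofReal_pow, Complex.ofReal_natCast, ← this, sum_mul]
    exact sum_congr rfl fun x _ => by ring
  · intro s hs hst
    have := sum_mon_mul_conj (hm t ht) (hm s hs)
    rw [if_neg fun h => hst (he ht hs h).symm] at this
    calc _ = a t * conj (a s) * ∑ x : ι → ZMod m,
          (mon (e t) (rootPt x) : ℂ) * conj (mon (e s) (rootPt x) : ℂ) := by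
          rw [mul_sum]; exact sum_congr rfl fun x _ => by ring
      _ = 0 := by rw [this, mul_zero]

/-- A monomial of degree at most `2 * D` factors in at most `4 ^ D` ways. -/
theorem card_filter_add_eq_le [DecidableEq ι] {D : ℕ} (K : Finset κ) (e : κ → ι → ℕ)
    (he : Set.InjOn e K) (γ : ι → ℕ) (hγ : ∑ i, γ i ≤ 2 * D) :
    #{p ∈ K ×ˢ K | e p.1 + e p.2 = γ} ≤ 4 ^ D := by
  classical
  have h1 : #{p ∈ K ×ˢ K | e p.1 + e p.2 = γ} ≤ #(Iic γ) := by
    refine card_le_card_of_injOn (fun p => e p.1) ?_ ?_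
    · intro p hp
      simp only [coe_filter, mem_product, Set.mem_ofPred_eq] at hp
      simp only [coe_Iic, Set.mem_Iic, ← hp.2]
      exact le_add_of_nonneg_right zero_le
    · intro p hp q hq hpq
      simp only [coe_filter, mem_product, Set.mem_ofPred_eq] at hp hq
      simp only at hpq
      refine Prod.ext (he hp.1.1 hq.1.1 hpq) (he hp.1.2 hq.1.2 ?_)
      have := hp.2.trans hq.2.symm
      rw [hpq] at this
      exact add_left_cancel this
  refine h1.trans ?_
  rw [Pi.card_Iic]
  calc ∏ i, #(Iic (γ i)) ≤ ∏ i, 2 ^ γ i :=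
        prod_le_prod' fun i _ => by rw [Nat.card_Iic]; exact Nat.lt_two_pow_self
    _ = 2 ^ ∑ i, γ i := prod_pow_eq_pow_sum _ _ _
    _ ≤ 2 ^ (2 * D) := Nat.pow_le_pow_right (by norm_num) hγ
    _ = 4 ^ D := by rw [pow_mul]; norm_num

/-- An `L⁴`-`L²` inequality for polynomials of degree at most `D`: apply Parseval's identity to
the square, and the Cauchy-Schwarz inequality to its coefficients. -/
theorem sum_norm_pow_four_le [DecidableEq ι] {m D : ℕ} [NeZero m] (K : Finset κ)
    (e : κ → ι → ℕ) (a : κ → ℂ) (he : Set.InjOn e K) (hD : ∀ t ∈ K, ∑ i, e t i ≤ D)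
    (hm : 2 * D < m) :
    ∑ x : ι → ZMod m, ‖∑ t ∈ K, a t * (mon (e t) (rootPt x) : ℂ)‖ ^ 4
      ≤ (m : ℝ) ^ Fintype.card ι * 4 ^ D * (∑ t ∈ K, ‖a t‖ ^ 2) ^ 2 := by
  classical
  set G : Finset (ι → ℕ) := (K ×ˢ K).image fun p => e p.1 + e p.2 with hG
  set c : (ι → ℕ) → ℂ := fun γ => ∑ p ∈ K ×ˢ K with e p.1 + e p.2 = γ, a p.1 * a p.2 with hc
  have hdeg : ∀ γ ∈ G, ∑ i, γ i ≤ 2 * D := by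
    intro γ hγ
    obtain ⟨p, hp, rfl⟩ := mem_image.1 hγ
    rw [mem_product] at hp
    simp only [Pi.add_apply, sum_add_distrib]
    linarith [hD _ hp.1, hD _ hp.2]
  have hsq : ∀ x : ι → ZMod m, (∑ t ∈ K, a t * (mon (e t) (rootPt x) : ℂ)) ^ 2
      = ∑ γ ∈ G, c γ * (mon γ (rootPt x) : ℂ) := by
    intro x
    rw [sq, sum_mul_sum, ← sum_product',
      ← sum_fiberwise_of_maps_to (g := fun p : κ × κ => e p.1 + e p.2) (t := G)
        fun p hp => mem_image_of_mem _ hp]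
    refine sum_congr rfl fun γ _ => ?_
    rw [hc, sum_mul]
    refine sum_congr rfl fun p hp => ?_
    rw [← (mem_filter.1 hp).2, mon_add]
    push_cast
    ring
  have h4 : ∀ z : ℂ, ‖z‖ ^ 4 = ‖z ^ 2‖ ^ 2 := fun z => by rw [norm_pow]; ring
  simp only [h4, hsq]
  have hpars := sum_norm_sq_eq (m := m) G id c Function.injective_id.injOn fun γ hγ i =>
    lt_of_le_of_lt ((single_le_sum (f := γ) (fun _ _ => Nat.zero_le _) (mem_univ i)).trans
      (hdeg γ hγ)) hm
  simp only [id] at hpars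
  refine hpars.le.trans ?_
  rw [mul_assoc]
  refine mul_le_mul_of_nonneg_left ?_ (by positivity)
  have hcb : ∀ γ ∈ G, ‖c γ‖ ^ 2
      ≤ 4 ^ D * ∑ p ∈ K ×ˢ K with e p.1 + e p.2 = γ, ‖a p.1‖ ^ 2 * ‖a p.2‖ ^ 2 := by
    intro γ hγ
    calc ‖c γ‖ ^ 2 ≤ (∑ p ∈ K ×ˢ K with e p.1 + e p.2 = γ, ‖a p.1 * a p.2‖) ^ 2 :=
          pow_le_pow_left₀ (norm_nonneg _) (norm_sum_le _ _) 2
      _ ≤ #{p ∈ K ×ˢ K | e p.1 + e p.2 = γ} *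
            ∑ p ∈ K ×ˢ K with e p.1 + e p.2 = γ, ‖a p.1 * a p.2‖ ^ 2 := sq_sum_le_card_mul_sum_sq
      _ ≤ _ := by
          simp only [norm_mul, mul_pow]
          refine mul_le_mul_of_nonneg_right ?_ (by positivity)
          exact_mod_cast card_filter_add_eq_le K e he γ (hdeg γ hγ)
  refine (sum_le_sum hcb).trans (le_of_eq ?_)
  rw [← mul_sum, sum_fiberwise_of_maps_to (g := fun p : κ × κ => e p.1 + e p.2) (t := G)
        fun p hp => mem_image_of_mem _ hp, sq, sum_mul_sum, ← sum_product']

/-- Khinchine's inequality for polynomials of degree at most `D`, obtained by interpolating the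
`L²`-norm between the `L¹`-norm and the `L⁴`-norm. -/
theorem sqrt_sum_sq_le_sum_norm [DecidableEq ι] {m D : ℕ} [NeZero m] (K : Finset κ)
    (e : κ → ι → ℕ) (a : κ → ℂ) (he : Set.InjOn e K) (hD : ∀ t ∈ K, ∑ i, e t i ≤ D)
    (hm : 2 * D < m) :
    (m : ℝ) ^ Fintype.card ι * √(∑ t ∈ K, ‖a t‖ ^ 2)
      ≤ 2 ^ D * ∑ x : ι → ZMod m, ‖∑ t ∈ K, a t * (mon (e t) (rootPt x) : ℂ)‖ := by
  set f : (ι → ZMod m) → ℂ := fun x => ∑ t ∈ K, a t * (mon (e t) (rootPt x) : ℂ) with hf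
  set q : ℝ := (m : ℝ) ^ Fintype.card ι with hq
  set F : ℝ := √(∑ t ∈ K, ‖a t‖ ^ 2) with hF
  have hF2 : F ^ 2 = ∑ t ∈ K, ‖a t‖ ^ 2 := Real.sq_sqrt (by positivity)
  have hq0 : 0 < q := by
    have : (0 : ℝ) < m := by exact_mod_cast Nat.pos_of_ne_zero (NeZero.ne m)
    positivity
  have hF0 : 0 ≤ F := Real.sqrt_nonneg _
  have h2 : ∑ x, ‖f x‖ ^ 2 = q * F ^ 2 := by
    rw [hF2]
    exact sum_norm_sq_eq K e a he fun t ht i =>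
      lt_of_le_of_lt ((single_le_sum (f := e t) (fun _ _ => Nat.zero_le _) (mem_univ i)).trans
        (hD t ht)) (by omega)
  have h4 : ∑ x, ‖f x‖ ^ 4 ≤ q * 4 ^ D * F ^ 4 := by
    have := sum_norm_pow_four_le K e a he hD hm
    rw [← hF2] at this
    calc _ ≤ _ := this
      _ = _ := by ring
  set S : ℝ := ∑ x, ‖f x‖ with hS
  have hS0 : 0 ≤ S := sum_nonneg fun _ _ => norm_nonneg _
  have hH := sum_pow_card_le_prod_sum (ι := Fin 3)
    ![fun x => ‖f x‖, fun x => ‖f x‖, fun x => ‖f x‖ ^ 4] (fun x => ‖f x‖ ^ 2)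
    (by intro t x; fin_cases t <;> simp) (fun x => by positivity)
    (by intro x; simp only [Fin.prod_univ_three, Fintype.card_fin]; apply le_of_eq; simp; ring)
  simp only [Fintype.card_fin, Fin.prod_univ_three, h2, Matrix.cons_val] at hH
  rw [← hS] at hH
  rcases hF0.eq_or_lt with h0 | hFpos
  · rw [← h0]; simp only [mul_zero]; positivity
  have h5 : (q * F) ^ 2 ≤ (2 ^ D * S) ^ 2 := by
    have h6 : (q * F) ^ 2 * (q * F ^ 4) ≤ (2 ^ D * S) ^ 2 * (q * F ^ 4) := by
      calc (q * F) ^ 2 * (q * F ^ 4) = (q * F ^ 2) ^ 3 := by ring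
        _ ≤ S * S * ∑ x, ‖f x‖ ^ 4 := hH
        _ ≤ S * S * (q * 4 ^ D * F ^ 4) := by gcongr
        _ = (2 ^ D * S) ^ 2 * (q * F ^ 4) := by
          rw [show (4 : ℝ) ^ D = (2 ^ D) ^ 2 by rw [← pow_mul, mul_comm, pow_mul]; norm_num]; ring
    exact le_of_mul_le_mul_right h6 (by positivity)
  exact le_of_pow_le_pow_left₀ two_ne_zero (by positivity) h5

end FiniteTorus

/-! ### Multilinear forms -/

section Multilinear

variable {I A : Type*} [Fintype I] [Fintype A] [DecidableEq I] [DecidableEq A]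

theorem exists_circle_mul_eq_norm (c : ℂ) : ∃ u : Circle, (u : ℂ) * c = ‖c‖ := by
  rcases eq_or_ne c 0 with rfl | hc
  · exact ⟨1, by simp⟩
  · have hn : ‖conj c / ‖c‖‖ = 1 := by
      rw [norm_div, RCLike.norm_conj, Complex.norm_real, norm_norm, div_self (norm_ne_zero_iff.2 hc)]
    refine ⟨⟨conj c / ‖c‖, mem_sphere_zero_iff_norm.2 hn⟩, ?_⟩
    have : (‖c‖ : ℂ) ≠ 0 := by exact_mod_cast norm_ne_zero_iff.2 hc
    change conj c / ‖c‖ * c = ‖c‖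
    rw [div_mul_eq_mul_div, Complex.conj_mul', sq, mul_div_assoc, div_self this, mul_one]

/-- The exponent of the monomial `∏ l ≠ i, w (l, j l)`. -/
def offExp (i : I) (j : I → A) : I × A → ℕ := fun p => if p.1 ≠ i ∧ j p.1 = p.2 then 1 else 0

theorem mon_offExp (i : I) (j : I → A) (w : I × A → Circle) :
    mon (offExp i j) w = ∏ l, if l ≠ i then w (l, j l) else 1 := by
  rw [mon, Fintype.prod_prod_type]
  refine prod_congr rfl fun l _ => ?_
  by_cases hl : l = i
  · simp [offExp, hl]
  · simp [offExp, hl, pow_ite]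

theorem sum_offExp_le (i : I) (j : I → A) : ∑ p, offExp i j p ≤ Fintype.card I := by
  rw [Fintype.sum_prod_type, Fintype.card, card_eq_sum_ones]
  refine sum_le_sum fun l _ => ?_
  by_cases hl : l = i <;> simp [offExp, hl]

theorem injOn_offExp (i : I) (a : A) :
    Set.InjOn (offExp i) ((univ.filter fun j : I → A => j i = a : Finset (I → A)) : Set (I → A)) := by
  intro j hj j' hj' h
  simp only [coe_filter, mem_univ, true_and, Set.mem_ofPred_eq] at hj hj'
  funext l
  by_cases hl : l = i
  · rw [hl, hj, hj']
  · have := congrFun h (l, j l)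
    by_contra hne
    simp [offExp, hl, Ne.symm hne] at this

/-- Choosing the variables of the block `i` optimally turns the supremum of a multilinear form into
the sum of the moduli of its partial derivatives in that block. -/
theorem sum_norm_partial_le {M : ℝ} (b : (I → A) → ℂ)
    (h : ∀ w : I × A → Circle, ‖∑ j, b j * ((∏ l, w (l, j l) : Circle) : ℂ)‖ ≤ M) (i : I)
    (w : I × A → Circle) :
    ∑ a, ‖∑ j with j i = a, b j * (mon (offExp i j) w : ℂ)‖ ≤ M := by
  choose u hu using fun a =>
    exists_circle_mul_eq_norm (∑ j with j i = a, b j * (mon (offExp i j) w : ℂ))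
  have h1 := h fun p => if p.1 = i then u p.2 else w p
  have h2 : ∀ j : I → A, (∏ l, if l = i then u (j l) else w (l, j l))
      = u (j i) * mon (offExp i j) w := by
    intro j
    have : u (j i) = ∏ l, if l = i then u (j l) else 1 := by simp
    rw [mon_offExp, this, ← prod_mul_distrib]
    refine prod_congr rfl fun l _ => ?_
    by_cases hl : l = i <;> simp [hl]
  have h3 : ∑ j, b j * ((∏ l, if l = i then u (j l) else w (l, j l) : Circle) : ℂ)
      = ((∑ a, ‖∑ j with j i = a, b j * (mon (offExp i j) w : ℂ)‖ : ℝ) : ℂ) := by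
    push_cast
    rw [← sum_fiberwise univ fun j : I → A => j i]
    refine sum_congr rfl fun a _ => ?_
    rw [← hu, mul_sum]
    refine sum_congr rfl fun j hj => ?_
    rw [h2, (mem_filter.1 hj).2]
    push_cast
    ring
  simp only at h1
  rw [h3, Complex.norm_real, Real.norm_of_nonneg (sum_nonneg fun _ _ => norm_nonneg _)] at h1
  exact h1

/-- The mixed `(ℓ¹, ℓ²)` inequality of Littlewood for multilinear forms. -/
theorem sum_sqrt_le {M : ℝ} (b : (I → A) → ℂ)
    (h : ∀ w : I × A → Circle, ‖∑ j, b j * ((∏ l, w (l, j l) : Circle) : ℂ)‖ ≤ M) (i : I) :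
    ∑ a, √(∑ j with j i = a, ‖b j‖ ^ 2) ≤ 2 ^ Fintype.card I * M := by
  set m : ℕ := 2 * Fintype.card I + 1 with hm
  set q : ℝ := (m : ℝ) ^ Fintype.card (I × A) with hq
  have hq0 : 0 < q := by positivity
  refine le_of_mul_le_mul_left ?_ hq0
  calc q * ∑ a, √(∑ j with j i = a, ‖b j‖ ^ 2)
      = ∑ a, q * √(∑ j with j i = a, ‖b j‖ ^ 2) := mul_sum _ _ _
    _ ≤ ∑ a, 2 ^ Fintype.card I * ∑ x : I × A → ZMod m,
          ‖∑ j with j i = a, b j * (mon (offExp i j) (rootPt x) : ℂ)‖ :=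
        sum_le_sum fun a _ => sqrt_sum_sq_le_sum_norm (m := m) (D := Fintype.card I) _ (offExp i) b
          (injOn_offExp i a) (fun j _ => sum_offExp_le i j) (by omega)
    _ = 2 ^ Fintype.card I * ∑ x : I × A → ZMod m, ∑ a,
          ‖∑ j with j i = a, b j * (mon (offExp i j) (rootPt x) : ℂ)‖ := by
        rw [← mul_sum, sum_comm]
    _ ≤ 2 ^ Fintype.card I * ∑ x : I × A → ZMod m, M := by
        gcongr with x
        exact sum_norm_partial_le b h i (rootPt x)
    _ = q * (2 ^ Fintype.card I * M) := by
        simp only [sum_const, card_univ, nsmul_eq_mul, Fintype.card_fun, ZMod.card]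
        rw [hq]
        push_cast
        ring

/-- A form of Blei's inequality: in a family of `k`-dimensional arrays with bounded mixed
`(ℓ¹, ℓ²)` norms, the total `ℓ²`-mass is controlled by the total `ℓ⁴`-mass. It is Hölder's
inequality for the `k + 2` functions `|Q|² / F i` (one for each direction `i`), `∏ i, F i`
and `|Q|⁴`, whose product is `|Q| ^ (2 * k + 4)`. -/
theorem sum_sq_pow_le {X : Type*} [Fintype X] {B : ℝ} (Q : X → (I → A) → ℂ)
    (h : ∀ x i, ∑ a, √(∑ j with j i = a, ‖Q x j‖ ^ 2) ≤ B) :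
    (∑ x, ∑ j, ‖Q x j‖ ^ 2) ^ (Fintype.card I + 2)
      ≤ (Fintype.card X * B) ^ Fintype.card I
        * (Fintype.card X * B ^ Fintype.card I) * ∑ x, ∑ j, ‖Q x j‖ ^ 4 := by
  set F : X → I → A → ℝ := fun x i a => √(∑ j with j i = a, ‖Q x j‖ ^ 2) with hF
  have hF0 : ∀ x i a, 0 ≤ F x i a := fun x i a => Real.sqrt_nonneg _
  have hFsq : ∀ x i a, F x i a ^ 2 = ∑ j with j i = a, ‖Q x j‖ ^ 2 := fun x i a =>
    Real.sq_sqrt (sum_nonneg fun _ _ => by positivity)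
  have hFQ : ∀ x i j, F x i (j i) = 0 → Q x j = 0 := by
    intro x i j h0
    have h1 := hFsq x i (j i)
    rw [h0, zero_pow two_ne_zero, eq_comm, sum_eq_zero_iff_of_nonneg fun _ _ => by positivity] at h1
    simpa using h1 j (by simp)
  have hH := sum_pow_card_le_prod_sum (ι := I ⊕ Bool) (X := X × (I → A))
    (Sum.elim (fun i p => ‖Q p.1 p.2‖ ^ 2 / F p.1 i (p.2 i))
      (fun t p => if t then ∏ i, F p.1 i (p.2 i) else ‖Q p.1 p.2‖ ^ 4))
    (fun p => ‖Q p.1 p.2‖ ^ 2)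
    (by
      rintro (i | t) p
      · exact div_nonneg (by positivity) (hF0 _ _ _)
      · cases t
        · simp
        · simpa using prod_nonneg fun i _ => hF0 p.1 i (p.2 i))
    (fun p => by positivity)
    (by
      rintro ⟨x, j⟩
      simp only [Fintype.card_sum, Fintype.card_bool, Fintype.prod_sum_type, Sum.elim_inl,
        Sum.elim_inr, Fintype.prod_bool, if_true, Bool.false_eq_true, if_false, prod_div_distrib]
      -- if some `F x i (j i)` vanishes, so does `Q x j`, and the value `0` of the quotient is harmless
      by_cases hz : ∃ i, F x i (j i) = 0
      · obtain ⟨i, hi⟩ := hz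
        simp [hFQ x i j hi]
      · push Not at hz
        have : ∏ i, F x i (j i) ≠ 0 := prod_ne_zero_iff.2 fun i _ => hz i
        rw [← mul_assoc, div_mul_cancel₀ _ this, prod_const, card_univ]
        apply le_of_eq
        ring)
  simp only [Fintype.card_sum, Fintype.card_bool, Fintype.prod_sum_type, Sum.elim_inl,
        Sum.elim_inr, Fintype.prod_bool, if_true, Bool.false_eq_true, if_false,
        Fintype.sum_prod_type] at hH
  refine hH.trans ?_
  rw [← mul_assoc]
  refine mul_le_mul_of_nonneg_right ?_ (by positivity)
  have hX : ∀ {g : X → ℝ} {c : ℝ}, (∀ x, g x ≤ c) → ∑ x, g x ≤ Fintype.card X * c := by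
    intro g c hg
    calc ∑ x, g x ≤ ∑ _x : X, c := sum_le_sum fun x _ => hg x
      _ = _ := by simp
  have h1 : ∀ i, ∑ x, ∑ j : I → A, ‖Q x j‖ ^ 2 / F x i (j i) ≤ Fintype.card X * B := by
    intro i
    refine hX fun x => (le_of_eq ?_).trans (h x i)
    rw [← sum_fiberwise univ fun j : I → A => j i]
    refine sum_congr rfl fun a _ => ?_
    calc ∑ j with j i = a, ‖Q x j‖ ^ 2 / F x i (j i)
        = ∑ j with j i = a, ‖Q x j‖ ^ 2 / F x i a :=
          sum_congr rfl fun j hj => by rw [(mem_filter.1 hj).2]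
      _ = F x i a := by rw [← sum_div, ← hFsq, sq, mul_self_div_self]
  have h2 : ∑ x, ∑ j : I → A, ∏ i, F x i (j i) ≤ Fintype.card X * B ^ Fintype.card I := by
    refine hX fun x => ?_
    rw [← Fintype.prod_sum fun i a => F x i a, Fintype.card, ← prod_const]
    exact prod_le_prod (fun i _ => sum_nonneg fun a _ => hF0 x i a) fun i _ => h x i
  refine mul_le_mul ?_ h2 (sum_nonneg fun x _ => sum_nonneg fun j _ =>
    prod_nonneg fun i _ => hF0 _ _ _) ?_
  · exact (prod_le_prod (fun i _ => sum_nonneg fun x _ => sum_nonneg fun j _ =>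
      div_nonneg (by positivity) (hF0 _ _ _)) fun i _ => h1 i).trans (by simp)
  · rcases isEmpty_or_nonempty I with hI | ⟨⟨i⟩⟩
    · simp
    · exact pow_nonneg (le_trans (sum_nonneg fun x _ => sum_nonneg fun j _ =>
        div_nonneg (by positivity) (hF0 _ _ _)) (h1 i)) _

end Multilinear

/-! ### Block-linear parts of a polynomial -/

section Blocks

variable {ι I A : Type*} [Fintype ι] [Fintype I] [Fintype A]
  [DecidableEq A]

/-- The exponent of the monomial `z ^ β * ∏ l, w (l, j l)`, linear in each block `w (l, ·)`. -/
def blockExp (β : ι →₀ ℕ) (j : I → A) : ι ⊕ I × A →₀ ℕ :=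
  Finsupp.equivFunOnFinite.symm (Sum.elim β fun p => if j p.1 = p.2 then 1 else 0)

/-- The coefficient of `∏ l, w (l, j l)` in `P`, as a polynomial of degree `D` in the variables `z`
outside the blocks. -/
def blockCoeff [DecidableEq ι] (P : MvPolynomial (ι ⊕ I × A) ℂ) (D : ℕ) (z : ι → Circle)
    (j : I → A) : ℂ :=
  ∑ β ∈ finsuppAntidiag univ D, P.coeff (blockExp β j) * (mon β z : ℂ)

theorem blockExp_injective :
    Function.Injective fun p : (ι →₀ ℕ) × (I → A) => blockExp p.1 p.2 := by
  rintro ⟨β, j⟩ ⟨β', j'⟩ h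
  simp only at h
  refine Prod.ext (Finsupp.ext fun t => ?_) (funext fun l => ?_)
  · simpa [blockExp] using DFunLike.congr_fun h (Sum.inl t)
  · have := DFunLike.congr_fun h (Sum.inr (l, j l))
    by_contra hne
    simp only at hne
    simp [blockExp, Ne.symm hne] at this

theorem mon_blockExp (β : ι →₀ ℕ) (j : I → A) (z : ι → Circle) (w : I × A → Circle) :
    mon (blockExp β j) (Sum.elim z w) = mon β z * ∏ l, w (l, j l) := by
  simp [mon, blockExp, Fintype.prod_prod_type, pow_ite]

/-- An exponent of degree `D + card I` and of degree one in each block comes from a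
`blockExp`. -/
theorem exists_blockExp_eq [DecidableEq ι] {D : ℕ} (α : ι ⊕ I × A →₀ ℕ)
    (hd : ∑ p, α p = D + Fintype.card I)
    (hb : ∀ l, ∑ a, α (Sum.inr (l, a)) = 1) :
    ∃ β ∈ finsuppAntidiag (univ : Finset ι) D, ∃ j : I → A, blockExp β j = α := by
  have h1 : ∀ l, ∃ a, ∀ a', α (Sum.inr (l, a')) = if a = a' then 1 else 0 := by
    intro l
    have hne : ∃ a, α (Sum.inr (l, a)) ≠ 0 := by
      by_contra! h0
      simpa [h0] using hb l
    obtain ⟨a, ha⟩ := hne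
    have hs := add_sum_erase univ (fun a => α (Sum.inr (l, a))) (mem_univ a)
    rw [hb l] at hs
    have hrest : ∑ x ∈ univ.erase a, α (Sum.inr (l, x)) = 0 := by omega
    refine ⟨a, fun a' => ?_⟩
    split_ifs with h
    · subst h
      omega
    · exact (sum_eq_zero_iff.1 hrest) a' (mem_erase.2 ⟨fun h' => h h'.symm, mem_univ _⟩)
  choose j hj using h1
  refine ⟨Finsupp.equivFunOnFinite.symm fun t => α (Sum.inl t), ?_, j, ?_⟩
  · rw [mem_finsuppAntidiag]
    refine ⟨?_, subset_univ _⟩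
    rw [Fintype.sum_sum_type, Fintype.sum_prod_type] at hd
    simp only [hb, sum_const, card_univ, smul_eq_mul, mul_one] at hd
    simpa using hd
  · ext p
    rcases p with t | ⟨l, a⟩
    · simp [blockExp]
    · simp [blockExp, hj]

/-- Taking the part of `P` that is linear in each block does not increase the supremum over the
torus, since this part is an average of rotations of `P` times unimodular factors. -/
theorem norm_sum_blockCoeff_le [DecidableEq ι] [DecidableEq I] {M : ℝ} {D : ℕ}
    (P : MvPolynomial (ι ⊕ I × A) ℂ)
    (hP : P.IsHomogeneous (D + Fintype.card I))
    (hM : ∀ y : ι ⊕ I × A → Circle, ‖MvPolynomial.eval (fun p => (y p : ℂ)) P‖ ≤ M)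
    (z : ι → Circle) (w : I × A → Circle) :
    ‖∑ j, blockCoeff P D z j * ((∏ l, w (l, j l) : Circle) : ℂ)‖ ≤ M := by
  set d := D + Fintype.card I with hd
  -- more than the degree of `P`, so that averaging over `m`-th roots of unity separates exponents
  set m := d + 2 with hm
  -- the degrees of an exponent in the blocks
  set bd : (ι ⊕ I × A →₀ ℕ) → I → ℕ := fun α l => ∑ a, α (Sum.inr (l, a)) with hbd
  have hdeg : ∀ α ∈ P.support, ∑ p, α p = d := fun α hα => sum_eq_of_mem_support hP hα
  set q : ℂ := (m : ℂ) ^ Fintype.card I with hq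
  have hrot : ∀ (s : I → Circle) (α : ι ⊕ I × A →₀ ℕ),
      mon α (Sum.elim z fun p => s p.1 * w p) = mon (bd α) s * mon α (Sum.elim z w) := by
    intro s α
    simp only [mon, Fintype.prod_sum_type, Sum.elim_inl, Sum.elim_inr, mul_pow, prod_mul_distrib,
      Fintype.prod_prod_type, hbd, prod_pow_eq_pow_sum]
    exact mul_left_comm _ _ _
  have havg : ∑ x : I → ZMod m, MvPolynomial.eval
        (fun p => ((Sum.elim z fun p => rootPt x p.1 * w p : ι ⊕ I × A → Circle) p : ℂ)) P
        * conj (mon (fun _ => 1) (rootPt x) : ℂ)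
      = q * ∑ α ∈ P.support with bd α = fun _ => 1, P.coeff α * (mon α (Sum.elim z w) : ℂ) := by
    simp only [eval_eq_sum_mon, hrot, sum_mul]
    rw [sum_comm, sum_filter, mul_sum]
    refine sum_congr rfl fun α hα => ?_
    have hlt : ∀ l, bd α l < m := by
      intro l
      have h1 : ∑ l, bd α l ≤ d := by
        rw [← hdeg α hα, Fintype.sum_sum_type, Fintype.sum_prod_type]
        exact Nat.le_add_left _ _
      have h2 := single_le_sum (f := bd α) (fun _ _ => Nat.zero_le _) (mem_univ l)
      omega
    have horth := sum_mon_mul_conj (α := bd α) (β := fun _ => 1) hlt fun _ => by omega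
    calc _ = P.coeff α * (mon α (Sum.elim z w) : ℂ) * ∑ x : I → ZMod m,
            (mon (bd α) (rootPt x) : ℂ) * conj (mon (fun _ => 1) (rootPt x) : ℂ) := by
          rw [mul_sum]
          refine sum_congr rfl fun x _ => ?_
          push_cast
          ring
      _ = _ := by
          rw [horth]
          split_ifs
          · ring
          · simp
  have hblock : ∑ α ∈ P.support with bd α = fun _ => 1, P.coeff α * (mon α (Sum.elim z w) : ℂ)
      = ∑ j, blockCoeff P D z j * ((∏ l, w (l, j l) : Circle) : ℂ) := by
    have h1 : ∑ j, blockCoeff P D z j * ((∏ l, w (l, j l) : Circle) : ℂ)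
        = ∑ p ∈ finsuppAntidiag (univ : Finset ι) D ×ˢ (univ : Finset (I → A)),
          P.coeff (blockExp p.1 p.2) * (mon (blockExp p.1 p.2) (Sum.elim z w) : ℂ) := by
      rw [sum_product_right]
      refine sum_congr rfl fun j _ => ?_
      rw [blockCoeff, sum_mul]
      refine sum_congr rfl fun β _ => ?_
      rw [mon_blockExp]
      push_cast
      ring
    rw [h1, ← sum_image (f := fun α => P.coeff α * (mon α (Sum.elim z w) : ℂ))
      blockExp_injective.injOn]
    refine sum_subset ?_ ?_
    · intro α hα
      obtain ⟨hα1, hα2⟩ := mem_filter.1 hα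
      obtain ⟨β, hβ, j, hj⟩ := exists_blockExp_eq (D := D) α (hdeg α hα1) (congrFun hα2)
      exact mem_image.2 ⟨(β, j), mem_product.2 ⟨hβ, mem_univ _⟩, hj⟩
    · intro α hα hα'
      obtain ⟨p, _, rfl⟩ := mem_image.1 hα
      have h2 : bd (blockExp p.1 p.2) = fun _ => 1 := by
        funext l
        simp [hbd, blockExp]
      have h3 : P.coeff (blockExp p.1 p.2) = 0 := by
        by_contra hne
        exact hα' (mem_filter.2 ⟨MvPolynomial.mem_support_iff.2 hne, h2⟩)
      simp [h3]
  have hq0 : 0 < ‖q‖ := by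
    rw [hq, norm_pow, Complex.norm_natCast]
    positivity
  refine le_of_mul_le_mul_left ?_ hq0
  rw [← hblock, ← norm_mul, ← havg]
  refine (norm_sum_le _ _).trans ?_
  calc _ ≤ ∑ _x : I → ZMod m, M := by
        refine sum_le_sum fun x _ => ?_
        rw [norm_mul, RCLike.norm_conj, Circle.norm_coe, mul_one]
        exact hM _
    _ = ‖q‖ * M := by
        rw [hq, norm_pow, Complex.norm_natCast]
        simp [ZMod.card]

/-- The lower bound for the supremum of a polynomial with unimodular coefficients in terms of the
numbers of variables in and outside of the blocks. -/
theorem card_pow_mul_card_le [DecidableEq ι] [DecidableEq I] {M : ℝ} {D : ℕ}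
    (P : MvPolynomial (ι ⊕ I × A) ℂ)
    (hP : P.IsHomogeneous (D + Fintype.card I))
    (hM : ∀ y : ι ⊕ I × A → Circle, ‖MvPolynomial.eval (fun p => (y p : ℂ)) P‖ ≤ M)
    (hcoeff : ∀ β ∈ finsuppAntidiag (univ : Finset ι) D, ∀ j : I → A,
      ‖P.coeff (blockExp β j)‖ = 1)
    (hI : 0 < Fintype.card I) (hD : D ≤ Fintype.card I * (Fintype.card I + 2)) :
    (Fintype.card A : ℝ) ^ (Fintype.card I + 1) * #(finsuppAntidiag (univ : Finset ι) D)
      ≤ 4 ^ (2 * Fintype.card I + 2) * M ^ 2 := by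
  set k := Fintype.card I with hk
  set n : ℝ := (Fintype.card A : ℝ) with hn
  set N : ℝ := (#(finsuppAntidiag (univ : Finset ι) D) : ℝ) with hN
  set m : ℕ := 2 * D + 1 with hm
  set q : ℝ := (m : ℝ) ^ Fintype.card ι with hq
  have hq0 : 0 < q := by positivity
  have hM0 : 0 ≤ M := (norm_nonneg _).trans (hM fun _ => 1)
  have hn0 : 0 ≤ n := by positivity
  have hN0 : 0 ≤ N := by positivity
  rcases hn0.eq_or_lt with h0 | hnpos
  · rw [← h0, zero_pow (by omega), zero_mul]
    positivity
  rcases hN0.eq_or_lt with h0 | hNpos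
  · rw [← h0, mul_zero]
    positivity
  have hinj : Set.InjOn (fun β : ι →₀ ℕ => (β : ι → ℕ)) (finsuppAntidiag (univ : Finset ι) D) :=
    DFunLike.coe_injective.injOn
  have hdeg : ∀ β ∈ finsuppAntidiag (univ : Finset ι) D, ∑ i, β i ≤ D := fun β hβ =>
    (mem_finsuppAntidiag.1 hβ).1.le
  have hone : ∀ j : I → A, ∑ β ∈ finsuppAntidiag (univ : Finset ι) D,
      ‖P.coeff (blockExp β j)‖ ^ 2 = N := by
    intro j
    rw [sum_congr rfl fun β hβ => by rw [hcoeff β hβ j, one_pow]]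
    simp [hN]
  have h2 : ∑ x : ι → ZMod m, ∑ j : I → A, ‖blockCoeff P D (rootPt x) j‖ ^ 2 = q * n ^ k * N := by
    have : ∀ j : I → A, ∑ x : ι → ZMod m, ‖blockCoeff P D (rootPt x) j‖ ^ 2 = q * N := by
      intro j
      rw [← hone j]
      exact sum_norm_sq_eq _ _ _ hinj fun β hβ i =>
        lt_of_le_of_lt ((single_le_sum (f := β) (fun _ _ => Nat.zero_le _) (mem_univ i)).trans
          (hdeg β hβ)) (by omega)
    rw [sum_comm, sum_congr rfl fun j _ => this j]
    simp only [sum_const, card_univ, Fintype.card_fun, nsmul_eq_mul]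
    push_cast
    ring
  have h4 : ∑ x : ι → ZMod m, ∑ j : I → A, ‖blockCoeff P D (rootPt x) j‖ ^ 4
      ≤ q * n ^ k * 4 ^ D * N ^ 2 := by
    have : ∀ j : I → A, ∑ x : ι → ZMod m, ‖blockCoeff P D (rootPt x) j‖ ^ 4
        ≤ q * 4 ^ D * N ^ 2 := by
      intro j
      rw [← hone j]
      exact sum_norm_pow_four_le _ _ _ hinj hdeg (by omega)
    rw [sum_comm]
    refine (sum_le_sum fun j _ => this j).trans (le_of_eq ?_)
    simp only [sum_const, card_univ, Fintype.card_fun, nsmul_eq_mul]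
    push_cast
    ring
  have hB := sum_sq_pow_le (fun x : ι → ZMod m => blockCoeff P D (rootPt x)) (B := 2 ^ k * M)
    fun x i => sum_sqrt_le _ (norm_sum_blockCoeff_le P hP hM (rootPt x)) i
  have hcard : (Fintype.card (ι → ZMod m) : ℝ) = q := by
    simp [hq, ZMod.card]
  rw [h2, hcard, ← hk] at hB
  -- the common factors of `hB` cancel, and what is left is a `k`-th power
  have h5 : (n ^ (k + 1) * N) ^ k ≤ (4 ^ (2 * k + 2) * M ^ 2) ^ k := by
    have hpos : 0 < q ^ (k + 2) * n ^ k * N ^ 2 := by positivity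
    refine le_of_mul_le_mul_right ?_ hpos
    calc (n ^ (k + 1) * N) ^ k * (q ^ (k + 2) * n ^ k * N ^ 2)
        = (q * n ^ k * N) ^ (k + 2) := by ring
      _ ≤ (q * (2 ^ k * M)) ^ k * (q * (2 ^ k * M) ^ k) * (q * n ^ k * 4 ^ D * N ^ 2) :=
        hB.trans (mul_le_mul_of_nonneg_left h4 (by positivity))
      _ ≤ (q * (2 ^ k * M)) ^ k * (q * (2 ^ k * M) ^ k) *
            (q * n ^ k * 4 ^ (k * (k + 2)) * N ^ 2) := by
        gcongr
        norm_num
      _ = (4 ^ (2 * k + 2) * M ^ 2) ^ k * (q ^ (k + 2) * n ^ k * N ^ 2) := by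
        have h22 : ((2 : ℝ) ^ k) ^ 2 = 4 ^ k := by rw [← pow_mul, mul_comm, pow_mul]; norm_num
        calc _ = ((2 ^ k) ^ 2) ^ k * M ^ (2 * k) * 4 ^ (k * (k + 2)) *
              (q ^ (k + 2) * n ^ k * N ^ 2) := by ring
          _ = _ := by
            rw [h22]
            generalize (4 : ℝ) = c
            ring
  exact le_of_pow_le_pow_left₀ hI.ne' (by positivity) h5

end Blocks

/-! ### Non-decreasing maps and exponents -/

theorem toMultiset_sum_single {d n : ℕ} (i : Fin d → Fin n) :
    Finsupp.toMultiset (∑ s, Finsupp.single (i s) 1) = (List.ofFn i : Multiset (Fin n)) := by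
  rw [map_sum, ← Fin.univ_val_map]
  simp only [Finsupp.toMultiset_single, one_smul]
  rw [Finset.sum, ← Multiset.sum_map_singleton (Multiset.map i univ.val), Multiset.map_map]
  rfl

theorem injOn_sum_single (d n : ℕ) :
    Set.InjOn (fun i : Fin d → Fin n => ∑ s, Finsupp.single (i s) 1) (J d n) := by
  intro i hi j hj h
  simp only [J, coe_filter, mem_univ, true_and, Set.mem_ofPred_eq] at hi hj
  have h1 : (List.ofFn i : Multiset (Fin n)) = List.ofFn j := by
    rw [← toMultiset_sum_single, ← toMultiset_sum_single]
    exact congrArg _ h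
  exact List.ofFn_injective ((Multiset.coe_eq_coe.1 h1).eq_of_pairwise'
    hi.sortedLE_ofFn.pairwise hj.sortedLE_ofFn.pairwise)

theorem exists_mem_J_sum_single_eq {d n : ℕ} (α : Fin n →₀ ℕ) (hα : ∑ k, α k = d) :
    ∃ i ∈ J d n, ∑ s, Finsupp.single (i s) 1 = α := by
  have hlen : (Finsupp.toMultiset α).toList.length = d := by
    rw [Multiset.length_toList, Finsupp.card_toMultiset, ← hα, Finsupp.sum_fintype _ _ (by simp)]
    rfl
  set l := (Finsupp.toMultiset α).toList with hl
  subst hlen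
  set f : Fin l.length → Fin n := l.get with hf
  have h1 : ∑ s, Finsupp.single (f s) 1 = α := by
    classical
    rw [← Finsupp.toMultiset_toFinsupp (∑ s, Finsupp.single (f s) 1), toMultiset_sum_single, hf,
      List.ofFn_get, hl, Multiset.coe_toList, Finsupp.toMultiset_toFinsupp]
  refine ⟨f ∘ Tuple.sort f, by simp [J, Tuple.monotone_sort], ?_⟩
  rw [← h1]
  exact Equiv.sum_comp (Tuple.sort f) fun s => Finsupp.single (f s) 1

theorem card_J_le_multichoose (d n : ℕ) : #(J d n) ≤ n.multichoose d := by
  have h := card_finsuppAntidiag_nat_eq_multichoose (s := (univ : Finset (Fin n))) d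
  rw [card_univ, Fintype.card_fin] at h
  rw [← h]
  refine card_le_card_of_injOn _ (fun i _ => ?_) (injOn_sum_single d n)
  simp only [mem_coe, mem_finsuppAntidiag,
    Finsupp.finsetSum_apply, subset_univ, and_true]
  rw [sum_comm]
  simp [Finsupp.single_apply]

theorem card_J_le_pow (d n : ℕ) : #(J d n) ≤ n ^ d := by
  simpa using card_le_univ (J d n)

theorem factorial_mul_multichoose (n k : ℕ) :
    k.factorial * n.multichoose k = n.ascFactorial k := by
  rw [Nat.multichoose_eq, Nat.ascFactorial_eq_factorial_mul_choose']

/-! ### Lower bounds for the supremum norm -/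

theorem norm_eval_le_torusNorm {n : ℕ} (P : MvPolynomial (Fin n) ℂ) (z : Fin n → Circle) :
    ‖MvPolynomial.eval (fun k => (z k : ℂ)) P‖ ≤ torusNorm P :=
  le_ciSup (bddAbove_torus P) z

theorem torusNorm_nonneg {n : ℕ} (P : MvPolynomial (Fin n) ℂ) : 0 ≤ torusNorm P :=
  (norm_nonneg _).trans (norm_eval_le_torusNorm P 1)

theorem norm_coeff_eq_one {d n : ℕ} {P : MvPolynomial (Fin n) ℂ}
    (h1 : ∀ i ∈ J d n, ‖coeffAt P i‖ = 1) {α : Fin n →₀ ℕ} (hα : ∑ k, α k = d) :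
    ‖P.coeff α‖ = 1 := by
  obtain ⟨i, hi, rfl⟩ := exists_mem_J_sum_single_eq α hα
  exact h1 i hi

/-- The supremum of `P` is at least its `L²`-norm. -/
theorem card_J_le_torusNorm_sq {d n : ℕ} {P : MvPolynomial (Fin n) ℂ} (hP : P.IsHomogeneous d)
    (h1 : ∀ i ∈ J d n, ‖coeffAt P i‖ = 1) : (#(J d n) : ℝ) ≤ torusNorm P ^ 2 := by
  have hsub : #(J d n) ≤ #P.support := by
    refine card_le_card_of_injOn _ (fun i hi => ?_) (injOn_sum_single d n)
    refine MvPolynomial.mem_support_iff.2 fun h0 => ?_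
    have := h1 i hi
    rw [coeffAt, h0, norm_zero] at this
    exact zero_ne_one this
  set q : ℝ := ((d + 1 : ℕ) : ℝ) ^ Fintype.card (Fin n) with hq
  have hq0 : 0 < q := by positivity
  have hpars := sum_norm_sq_eq (m := d + 1) P.support (fun α => (α : Fin n → ℕ)) P.coeff
    DFunLike.coe_injective.injOn fun α hα k => Nat.lt_succ_of_le <|
      (single_le_sum (f := α) (fun _ _ => Nat.zero_le _) (mem_univ k)).trans
        (sum_eq_of_mem_support hP hα).le
  have hone : ∑ α ∈ P.support, ‖P.coeff α‖ ^ 2 = #P.support := by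
    rw [sum_congr rfl fun α hα => by
      rw [norm_coeff_eq_one h1 (sum_eq_of_mem_support hP hα), one_pow]]
    simp
  refine le_of_mul_le_mul_left ?_ hq0
  calc q * #(J d n) ≤ q * #P.support := by gcongr
    _ = ∑ x : Fin n → ZMod (d + 1),
          ‖∑ α ∈ P.support, P.coeff α * (mon α (rootPt x) : ℂ)‖ ^ 2 := by
      rw [← hone]
      exact hpars.symm
    _ ≤ ∑ _x : Fin n → ZMod (d + 1), torusNorm P ^ 2 := by
      refine sum_le_sum fun x _ => ?_
      rw [← eval_eq_sum_mon]
      exact pow_le_pow_left₀ (norm_nonneg _) (norm_eval_le_torusNorm P _) 2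
    _ = q * torusNorm P ^ 2 := by simp [hq, ZMod.card]

theorem pow_mul_multichoose_le_torusNorm_sq {D k n₀ n₁ : ℕ} (hk : 0 < k) (hD : D ≤ k * (k + 2))
    {P : MvPolynomial (Fin (n₀ + k * n₁)) ℂ} (hP : P.IsHomogeneous (D + k))
    (h1 : ∀ i ∈ J (D + k) (n₀ + k * n₁), ‖coeffAt P i‖ = 1) :
    (n₁ : ℝ) ^ (k + 1) * n₀.multichoose D ≤ 4 ^ (2 * k + 2) * torusNorm P ^ 2 := by
  let e : Fin (n₀ + k * n₁) ≃ Fin n₀ ⊕ Fin k × Fin n₁ :=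
    finSumFinEquiv.symm.trans (Equiv.sumCongr (Equiv.refl _) finProdFinEquiv.symm)
  have h := card_pow_mul_card_le (ι := Fin n₀) (I := Fin k) (A := Fin n₁) (M := torusNorm P)
    (D := D) (MvPolynomial.rename e P)
    (by rw [Fintype.card_fin]; exact hP.rename_isHomogeneous)
    (fun y => by
      rw [MvPolynomial.eval_rename]
      exact norm_eval_le_torusNorm P (y ∘ e))
    (fun β hβ j => by
      have h2 : blockExp β j = (Finsupp.mapDomain e.symm (blockExp β j)).mapDomain e := by
        rw [← Finsupp.mapDomain_comp, Equiv.self_comp_symm, Finsupp.mapDomain_id]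
      rw [h2, MvPolynomial.coeff_rename_mapDomain _ e.injective]
      refine norm_coeff_eq_one h1 ?_
      have h3 : ∀ t, Finsupp.mapDomain e.symm (blockExp β j) t = blockExp β j (e t) := fun t => by
        rw [← Finsupp.equivMapDomain_eq_mapDomain, Finsupp.equivMapDomain_apply, Equiv.symm_symm]
      simp only [h3]
      rw [Equiv.sum_comp e (blockExp β j), Fintype.sum_sum_type, Fintype.sum_prod_type]
      have h4 := (mem_finsuppAntidiag.1 hβ).1
      simp [blockExp, h4])
    (by simpa using hk) (by simpa using hD)
  simpa [card_finsuppAntidiag_nat_eq_multichoose] using h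

/-! ### Counting estimates -/

theorem add_pow_le_pow_mul_exp {x y : ℝ} (hx : 0 < x) (hy : 0 ≤ y) (r : ℕ) :
    (x + y) ^ r ≤ x ^ r * Real.exp (r * (y / x)) := by
  rw [Real.exp_nat_mul, ← mul_pow]
  refine pow_le_pow_left₀ (by positivity) ?_ r
  calc x + y = x * (y / x + 1) := by field_simp; ring
    _ ≤ x * Real.exp (y / x) := by gcongr; exact Real.add_one_le_exp _

theorem exp_natCast_le_three_pow (k : ℕ) : Real.exp k ≤ 3 ^ k := by
  rw [← Real.exp_one_pow]
  exact pow_le_pow_left₀ (Real.exp_pos _).le Real.exp_one_lt_three.le k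

theorem add_pow_le_three_pow_mul (D k : ℕ) : ((D : ℝ) + k) ^ D ≤ 3 ^ k * (D : ℝ) ^ D := by
  rcases Nat.eq_zero_or_pos D with rfl | hD
  · simpa using one_le_pow₀ (by norm_num : (1 : ℝ) ≤ 3)
  · have hD' : (0 : ℝ) < D := by exact_mod_cast hD
    refine (add_pow_le_pow_mul_exp hD' (Nat.cast_nonneg k) D).trans ?_
    rw [mul_div_cancel₀ _ hD'.ne', mul_comm]
    gcongr
    exact exp_natCast_le_three_pow k

theorem pow_self_le_three_pow_mul_factorial (d : ℕ) : (d : ℝ) ^ d ≤ 3 ^ d * d.factorial := by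
  have h := Real.pow_div_factorial_le_exp (d : ℝ) (Nat.cast_nonneg d) d
  rw [div_le_iff₀ (by positivity)] at h
  exact h.trans (by gcongr; exact exp_natCast_le_three_pow d)

theorem factorial_mul_multichoose_le {d n : ℕ} (hd : 1 ≤ d) (hn : d ^ 2 ≤ n) :
    (d.factorial : ℝ) * n.multichoose d ≤ 3 * (n : ℝ) ^ d := by
  have hn0 : 0 < n := lt_of_lt_of_le (by positivity) hn
  have h1 : d.factorial * n.multichoose d ≤ (n + d) ^ d := by
    obtain ⟨n', rfl⟩ := Nat.exists_eq_add_of_le' hn0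
    rw [factorial_mul_multichoose]
    exact (Nat.ascFactorial_le_pow_add n' d).trans (Nat.pow_le_pow_left (by omega) d)
  have hn' : (0 : ℝ) < n := by exact_mod_cast hn0
  calc (d.factorial : ℝ) * n.multichoose d ≤ ((n : ℝ) + d) ^ d := by exact_mod_cast h1
    _ ≤ (n : ℝ) ^ d * Real.exp (d * (d / n)) :=
      add_pow_le_pow_mul_exp hn' (Nat.cast_nonneg d) d
    _ ≤ (n : ℝ) ^ d * Real.exp 1 := by
      gcongr
      rw [← mul_div_assoc, div_le_one hn', ← sq]
      exact_mod_cast hn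
    _ ≤ 3 * (n : ℝ) ^ d := by
      rw [mul_comm]
      gcongr
      exact Real.exp_one_lt_three.le

theorem pow_mul_factorial_le {D k : ℕ} (hk : k ≤ D + 2) :
    (D + k) ^ k * D.factorial ≤ 2 ^ k * (D + k).factorial := by
  calc (D + k) ^ k * D.factorial ≤ (2 * (D + 1)) ^ k * D.factorial := by
        gcongr
        omega
    _ = 2 ^ k * (D.factorial * (D + 1) ^ k) := by rw [mul_pow]; ring
    _ ≤ 2 ^ k * (D.factorial * (D + 1).ascFactorial k) := by
        gcongr
        exact Nat.pow_succ_le_ascFactorial _ _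
    _ = 2 ^ k * (D + k).factorial := by rw [Nat.factorial_mul_ascFactorial]

/-- With `k` of the order of `√d`, blocks of `n / d` variables each are large enough for the
lower bound to be sharp up to a factor exponential in `√d`. -/
theorem pow_succ_le_torusNorm_sq {d n : ℕ} (hd : 1 ≤ d) (hn : d ^ 2 ≤ n)
    {P : MvPolynomial (Fin n) ℂ} (hP : P.IsHomogeneous d)
    (h1 : ∀ i ∈ J d n, ‖coeffAt P i‖ = 1) :
    (n : ℝ) ^ (d + 1) ≤ 32 * d * 192 ^ Nat.sqrt d * d.factorial * torusNorm P ^ 2 := by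
  have hk1 := Nat.sqrt_le d
  have hk2 := Nat.sqrt_le_add d
  have hk0 := Nat.sqrt_pos.2 hd
  have hkd := Nat.sqrt_le_self d
  generalize Nat.sqrt d = k at *
  obtain ⟨D, rfl⟩ := Nat.exists_eq_add_of_le' hkd
  have hkD : k ≤ D + 2 := by nlinarith
  have hmul := Nat.mul_div_le n (D + k)
  have hlt := Nat.lt_mul_div_succ n hd
  have hn₁pos : 1 ≤ n / (D + k) := (Nat.one_le_div_iff hd).2 (le_trans (by nlinarith) hn)
  generalize n / (D + k) = n₁ at *
  have hle : n ≤ 2 * (D + k) * n₁ := by nlinarith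
  obtain ⟨n₀, rfl⟩ : ∃ n₀, n = n₀ + k * n₁ := Nat.exists_eq_add_of_le' (by nlinarith)
  have hn₀ : (n₀ + k * n₁) * D ≤ n₀ * (D + k) := by nlinarith
  have hkey := pow_mul_multichoose_le_torusNorm_sq hk0 (by nlinarith) hP h1
  generalize n₀ + k * n₁ = n at *
  set N₀ := n₀.multichoose D with hN₀
  have hA : (n : ℝ) ^ D ≤ 3 ^ k * D.factorial * N₀ := by
    have hDD : (0 : ℝ) < (D : ℝ) ^ D := by
      rcases Nat.eq_zero_or_pos D with rfl | h <;> positivity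
    have h3 : (n₀ : ℝ) ^ D ≤ D.factorial * N₀ := by
      have := Nat.pow_succ_le_ascFactorial n₀ D
      rw [← factorial_mul_multichoose] at this
      exact_mod_cast this
    refine le_of_mul_le_mul_right ?_ hDD
    calc (n : ℝ) ^ D * (D : ℝ) ^ D = ((n : ℝ) * D) ^ D := by rw [mul_pow]
      _ ≤ ((n₀ : ℝ) * (D + k)) ^ D := by
        refine pow_le_pow_left₀ (by positivity) ?_ _
        exact_mod_cast hn₀
      _ = (n₀ : ℝ) ^ D * ((D : ℝ) + k) ^ D := by rw [mul_pow]
      _ ≤ (D.factorial * N₀) * (3 ^ k * (D : ℝ) ^ D) := by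
        gcongr
        exact add_pow_le_three_pow_mul D k
      _ = _ := by ring
  have hB : (n : ℝ) ^ (k + 1) ≤ (2 * (D + k)) ^ (k + 1) * (n₁ : ℝ) ^ (k + 1) := by
    rw [← mul_pow]
    refine pow_le_pow_left₀ (by positivity) ?_ _
    exact_mod_cast hle
  have hC : ((D : ℝ) + k) ^ k * D.factorial ≤ 2 ^ k * (D + k).factorial := by
    exact_mod_cast pow_mul_factorial_le hkD
  have h16 : (4 : ℝ) ^ (2 * k + 2) = 16 ^ k * 16 := by
    rw [pow_add, pow_mul]
    norm_num
  have h192 : (192 : ℝ) ^ k = 2 ^ k * 3 ^ k * 16 ^ k * 2 ^ k := by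
    rw [← mul_pow, ← mul_pow, ← mul_pow]
    norm_num
  push_cast
  calc (n : ℝ) ^ (D + k + 1) = (n : ℝ) ^ D * (n : ℝ) ^ (k + 1) := by ring
    _ ≤ (3 ^ k * D.factorial * N₀) * ((2 * (D + k)) ^ (k + 1) * (n₁ : ℝ) ^ (k + 1)) := by gcongr
    _ = 3 ^ k * D.factorial * (2 * (D + k)) ^ (k + 1) * ((n₁ : ℝ) ^ (k + 1) * N₀) := by ring
    _ ≤ 3 ^ k * D.factorial * (2 * (D + k)) ^ (k + 1) *
          (4 ^ (2 * k + 2) * torusNorm P ^ 2) := by gcongr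
    _ = 32 * (D + k) * (2 ^ k * 3 ^ k * 16 ^ k) * torusNorm P ^ 2 *
          (((D : ℝ) + k) ^ k * D.factorial) := by
      rw [h16, mul_pow 2]
      ring
    _ ≤ 32 * (D + k) * (2 ^ k * 3 ^ k * 16 ^ k) * torusNorm P ^ 2 *
          (2 ^ k * (D + k).factorial) := by gcongr
    _ = _ := by
      rw [h192]
      ring

theorem card_J_rpow_sq {d n : ℕ} (hd : 1 ≤ d) :
    ((#(J d n) : ℝ) ^ (((d : ℝ) + 1) / (2 * d))) ^ 2 = #(J d n) * (#(J d n) : ℝ) ^ ((d : ℝ)⁻¹) := by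
  have hd0 : (d : ℝ) ≠ 0 := by positivity
  have hN : (0 : ℝ) ≤ #(J d n) := Nat.cast_nonneg _
  rw [← Real.rpow_natCast, ← Real.rpow_mul hN]
  have : ((d : ℝ) + 1) / (2 * d) * (2 : ℕ) = 1 + (d : ℝ)⁻¹ := by
    push_cast
    field_simp
  rw [this, Real.rpow_add_of_nonneg hN zero_le_one (by positivity), Real.rpow_one]

/-- The inequality with a constant that is exponential in `√d`, and hence smaller than the
required one. -/
theorem card_J_rpow_le {d n : ℕ} (hd : 1 ≤ d) {P : MvPolynomial (Fin n) ℂ} (hP : P.IsHomogeneous d)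
    (h1 : ∀ i ∈ J d n, ‖coeffAt P i‖ = 1) :
    (#(J d n) : ℝ) ^ (((d : ℝ) + 1) / (2 * d)) ≤ 30 * 14 ^ Nat.sqrt d * torusNorm P := by
  have hd' : (0 : ℝ) < d := by exact_mod_cast hd
  have hM := torusNorm_nonneg P
  set N : ℝ := (#(J d n) : ℝ) with hNdef
  have hN : 0 ≤ N := Nat.cast_nonneg _
  set t : ℝ := N ^ ((d : ℝ)⁻¹) with ht
  have ht0 : 0 ≤ t := Real.rpow_nonneg hN _
  have htd : t ^ d = N := Real.rpow_inv_natCast_pow hN (by omega)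
  refine le_of_pow_le_pow_left₀ two_ne_zero (by positivity) ?_
  rw [card_J_rpow_sq hd]
  change N * t ≤ _
  -- few variables: Parseval's identity suffices; many variables: the block decomposition is needed
  rcases lt_or_ge n (d ^ 2) with hn | hn
  · have htn : t ≤ n := by
      refine le_of_pow_le_pow_left₀ (by omega : d ≠ 0) (Nat.cast_nonneg n) ?_
      rw [htd, hNdef]
      exact_mod_cast card_J_le_pow d n
    have htd2 : t ≤ (d : ℝ) ^ 2 := htn.trans (by exact_mod_cast hn.le)
    have hdk : (d : ℝ) ≤ 30 * 14 ^ Nat.sqrt d := by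
      have h2 : d < (Nat.sqrt d + 1) * (Nat.sqrt d + 1) := Nat.lt_succ_sqrt d
      have h3 : Nat.sqrt d + 1 ≤ 2 ^ Nat.sqrt d := Nat.lt_two_pow_self
      have h4 : d ≤ 4 ^ Nat.sqrt d := by
        calc d ≤ 2 ^ Nat.sqrt d * 2 ^ Nat.sqrt d := h2.le.trans (Nat.mul_le_mul h3 h3)
          _ = 4 ^ Nat.sqrt d := by rw [← mul_pow]; norm_num
      calc (d : ℝ) ≤ 4 ^ Nat.sqrt d := by exact_mod_cast h4
        _ ≤ 14 ^ Nat.sqrt d := by gcongr; norm_num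
        _ ≤ 30 * 14 ^ Nat.sqrt d := le_mul_of_one_le_left (by positivity) (by norm_num)
    calc N * t ≤ torusNorm P ^ 2 * (d : ℝ) ^ 2 :=
          mul_le_mul (card_J_le_torusNorm_sq hP h1) htd2 ht0 (by positivity)
      _ ≤ torusNorm P ^ 2 * (30 * 14 ^ Nat.sqrt d) ^ 2 := by gcongr
      _ = _ := by ring
  · have hNle : d.factorial * N ≤ 3 * (n : ℝ) ^ d := by
      refine le_trans ?_ (factorial_mul_multichoose_le hd hn)
      gcongr
      rw [hNdef]
      exact_mod_cast card_J_le_multichoose d n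
    have htle : d * t ≤ 9 * n := by
      refine le_of_pow_le_pow_left₀ (by omega : d ≠ 0) (by positivity) ?_
      calc ((d : ℝ) * t) ^ d = (d : ℝ) ^ d * N := by rw [mul_pow, htd]
        _ ≤ 3 ^ d * d.factorial * N := by
          gcongr
          exact pow_self_le_three_pow_mul_factorial d
        _ = 3 ^ d * (d.factorial * N) := by ring
        _ ≤ 3 ^ d * (3 * (n : ℝ) ^ d) := by gcongr
        _ ≤ 3 ^ d * (3 ^ d * (n : ℝ) ^ d) := by
          gcongr
          exact le_self_pow₀ (by norm_num) (by omega)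
        _ = (9 * n) ^ d := by
          rw [← mul_assoc, ← mul_pow, ← mul_pow]
          norm_num
    have hpos : (0 : ℝ) < d * d.factorial := by positivity
    refine le_of_mul_le_mul_left ?_ hpos
    calc (d : ℝ) * d.factorial * (N * t) = (d.factorial * N) * (d * t) := by ring
      _ ≤ (3 * (n : ℝ) ^ d) * (9 * n) := by gcongr
      _ = 27 * (n : ℝ) ^ (d + 1) := by ring
      _ ≤ 27 * (32 * d * 192 ^ Nat.sqrt d * d.factorial * torusNorm P ^ 2) := by
        gcongr
        exact pow_succ_le_torusNorm_sq hd hn hP h1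
      _ = d * d.factorial * (864 * 192 ^ Nat.sqrt d * torusNorm P ^ 2) := by ring
      _ ≤ d * d.factorial * (900 * 196 ^ Nat.sqrt d * torusNorm P ^ 2) := by
        gcongr <;> norm_num
      _ = d * d.factorial * (30 * 14 ^ Nat.sqrt d * torusNorm P) ^ 2 := by
        rw [show (196 : ℝ) ^ Nat.sqrt d = (14 ^ Nat.sqrt d) ^ 2 by
          rw [← pow_mul, mul_comm, pow_mul]; norm_num]
        ring

/-! ### Comparison of growth rates -/

theorem fourteen_pow_sqrt_le (d : ℕ) : (14 : ℝ) ^ Nat.sqrt d ≤ Real.exp (3 * √d) := by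
  have h14 : (14 : ℝ) ≤ Real.exp 3 := by
    have h := Real.exp_one_gt_d9
    calc (14 : ℝ) ≤ 2.7 ^ 3 := by norm_num
      _ ≤ Real.exp 1 ^ 3 := by gcongr; linarith
      _ = Real.exp 3 := by rw [Real.exp_one_pow]; norm_num
  calc (14 : ℝ) ^ Nat.sqrt d ≤ Real.exp 3 ^ Nat.sqrt d := by gcongr
    _ = Real.exp (Nat.sqrt d * 3) := by rw [Real.exp_nat_mul]
    _ ≤ Real.exp (3 * √d) := by
      rw [mul_comm]
      gcongr
      exact Real.nat_sqrt_le_real_sqrt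

/-- Up to an additive constant, `√d` is smaller than any positive multiple of `√(d * log d)`, as
`log d` tends to infinity. -/
theorem exists_mul_sqrt_le {a c : ℝ} (ha : 0 < a) (hc : 0 < c) :
    ∃ K : ℝ, ∀ d : ℕ, 1 ≤ d → a * √d ≤ K + c * √(d * Real.log d) := by
  refine ⟨a * √(Real.exp ((a / c) ^ 2)), fun d hd => ?_⟩
  have hd' : (0 : ℝ) < d := by exact_mod_cast hd
  rcases le_total (Real.log d) ((a / c) ^ 2) with h | h
  · have h2 : (d : ℝ) ≤ Real.exp ((a / c) ^ 2) := (Real.log_le_iff_le_exp hd').1 h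
    have h3 : 0 ≤ c * √(d * Real.log d) := by positivity
    have h4 : a * √d ≤ a * √(Real.exp ((a / c) ^ 2)) := by gcongr
    linarith
  · have h2 : a / c ≤ √(Real.log d) := Real.le_sqrt_of_sq_le h
    have h3 : a ≤ c * √(Real.log d) := by
      rwa [div_le_iff₀ hc, mul_comm] at h2
    have h4 : a * √d ≤ c * √(d * Real.log d) := by
      rw [Real.sqrt_mul hd'.le]
      calc a * √d ≤ c * √(Real.log d) * √d := by gcongr
        _ = _ := by ring
    have h5 : 0 ≤ a * √(Real.exp ((a / c) ^ 2)) := by positivity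
    linarith

end Sidon

end

theorem theorem1 (τ : ℝ) (hτ : 0 < τ) :
    ∃ C : ℝ, 0 < C ∧ ∀ d : ℕ, 1 ≤ d → ∀ n : ℕ, ∀ P : MvPolynomial (Fin n) ℂ,
      P.IsHomogeneous d →
      (∀ i ∈ Sidon.J d n, ‖Sidon.coeffAt P i‖ = 1) →
      (∑ i ∈ Sidon.J d n, ‖Sidon.coeffAt P i‖ ^ (2 * (d : ℝ) / ((d : ℝ) + 1)))
          ^ (((d : ℝ) + 1) / (2 * (d : ℝ)))
        ≤ C * Real.exp ((√2 / √3 + τ) * √((d : ℝ) * Real.log (d : ℝ))) * Sidon.torusNorm P := by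
  obtain ⟨K, hK⟩ := Sidon.exists_mul_sqrt_le (a := 3) (c := √2 / √3 + τ) (by norm_num)
    (by positivity)
  refine ⟨30 * Real.exp K, by positivity, fun d hd n P hP h1 => ?_⟩
  rw [Finset.sum_congr rfl fun i hi => by rw [h1 i hi, Real.one_rpow], Finset.sum_const,
    nsmul_eq_mul, mul_one]
  refine (Sidon.card_J_rpow_le hd hP h1).trans ?_
  have hM := Sidon.torusNorm_nonneg P
  refine mul_le_mul_of_nonneg_right ?_ hM
  rw [mul_assoc, ← Real.exp_add]
  gcongr
  exact (Sidon.fourteen_pow_sqrt_le d).trans (Real.exp_le_exp.2 (hK d hd))
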